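/- Consider the semilinear Dirichlet problem $-\Delta u + b(x,u) = 0$ in $\Omega\subset\mathbb R^d$, $u=0$ on $\partial\Omega$, for $d=1,2$. Here $b(x,\eta)$ is measurable in $x\in\Omega$ for each $\eta\in\mathbb R$ and $C^1$ in $\eta$ for a.e. $x\in\Omega$, and there is a constant $B_\eta\ge 0$ such that $0\le \frac{\partial b}{\partial\eta}(x,\eta)\le B_\eta$ for a.e. $x\in\Omega$ and all $\eta\in\mathbb R$. For $d=1$ let $\Omega=(\alpha,\beta)$ with a subdivision $\alpha=a_0<a_1<\dots<a_n=\beta$, $n\ge 1$, and put $h_k=a_k-a_{k-1}$ and $\mathcal T=\{[a_{k-1},a_k] : 1\le k\le n\}$. For $d=2$ let $\Omega$ be a bounded open set with a finite conforming triangulation $\mathcal T$: the closed triangles of $\mathcal T$ cover exactly $\overline\Omega$, any two of them are disjoint or meet in a common vertex, edge or triangle, and $\partial\Omega$ is a union of edges of $\mathcal T$. Suppose for $d=2$ that there are $0<t_{\min}\le t_{\max}<\pi/2$ such that all interior angles $\theta_{T,1},\theta_{T,2},\theta_{T,3}$ of all $T\in\mathcal T$ lie in $[t_{\min},t_{\max}]$;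 $|T|$ denotes the area of $T$. Let $\mathcal V$ be the space of continuous functions on $\overline\Omega$ that vanish on $\partial\Omega$ and are affine on each $T\in\mathcal T$. Let $u_1\in\mathcal V$ be a discrete subsolution and $u_2\in\mathcal V$ a discrete supersolution, i.e., for all $v\in\mathcal V$ with $v\ge0$, the functions $b(\cdot,u_1)v$ and $b(\cdot,u_2)v$ are integrable on $\Omega$ and $$\int_\Omega \nabla u_1\cdot\nabla v+b(x,u_1)\,v\,dx\le 0,\qquad \int_\Omega \nabla u_2\cdot\nabla v+b(x,u_2)\,v\,dx\ge 0 .$$ Assume $$h_k^2<\frac{2}{B_\eta},\quad k=1,\dots,n,\qquad\text{if } d=1,$$ $$|T|<\frac{3}{7B_\eta}\,\min_{k=1,2,3}\cot\theta_{T,k}\quad\text{for each }T\in\mathcal T,\qquad\text{if } d=2,$$ where these conditions are void if $B_\eta=0$. Then $u_1\le u_2$ in $\Omega$. -/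

import Mathlib

open Set MeasureTheory

namespace SemilinearFEM

section General

variable {E : Type*} [NormedAddCommGroup E] [InnerProductSpace ℝ E]

/-- The continuous piecewise linear (P1) finite element space on the cells `cells` of a mesh of
`Ω`, with homogeneous Dirichlet condition on `∂Ω`.  Its elements are identified with their
extension by zero to the whole space: a continuous function on the closure of `Ω` that vanishes on
`∂Ω` is the same thing as a continuous function on `E` that vanishes outside `Ω`. -/
def P1Space (Ω : Set E) (cells : Set (Set E)) : Set (E → ℝ) :=
  {u | Continuous u ∧ (∀ x, x ∉ Ω → u x = 0) ∧
    ∀ T ∈ cells, ∃ f : E →ᵃ[ℝ] ℝ, Set.EqOn u f T}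

/-- The nonlinearity `b` is a Carathéodory function on `Ω × ℝ`: (Lebesgue) measurable in `x` for
each `η`, and `C¹` in `η` for a.e. `x`; and `0 ≤ ∂b/∂η ≤ B` for a.e. `x ∈ Ω` and all `η`
(in particular `b x` is nondecreasing for a.e. `x`). -/
structure IsAdmissible [MeasureSpace E] (Ω : Set E) (b : E → ℝ → ℝ) (B : ℝ) : Prop where
  nonneg : 0 ≤ B
  measurable : ∀ η : ℝ, AEMeasurable (fun x => b x η) (volume.restrict Ω)
  contDiff : ∀ᵐ x ∂(volume.restrict Ω), ContDiff ℝ 1 (b x)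
  deriv_bound : ∀ᵐ x ∂(volume.restrict Ω), ∀ η : ℝ, 0 ≤ deriv (b x) η ∧ deriv (b x) η ≤ B

/-- The weak form `∫_Ω ∇u · ∇v + b(x,u) v dx`.  For `u`, `v` in a P1 space on a mesh of `Ω` the
gradients exist and are constant in the interior of each cell, hence are defined a.e. in `Ω`. -/
noncomputable def weakForm [CompleteSpace E] [MeasureSpace E] (Ω : Set E) (b : E → ℝ → ℝ)
    (u v : E → ℝ) : ℝ :=
  ∫ x in Ω, (inner ℝ (gradient u x) (gradient v x) + b x (u x) * v x)

/-- `u` is a discrete subsolution: `u` is in the P1 space, and for every nonnegative `v` in the P1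
space the weak form makes sense as an integral and is `≤ 0`. -/
def IsSubsolution [CompleteSpace E] [MeasureSpace E] (Ω : Set E) (cells : Set (Set E))
    (b : E → ℝ → ℝ) (u : E → ℝ) : Prop :=
  u ∈ P1Space Ω cells ∧ ∀ v ∈ P1Space Ω cells, (∀ x, 0 ≤ v x) →
    IntegrableOn (fun x => b x (u x) * v x) Ω ∧ weakForm Ω b u v ≤ 0

/-- `u` is a discrete supersolution: `u` is in the P1 space, and for every nonnegative `v` in the
P1 space the weak form makes sense as an integral and is `≥ 0`. -/
def IsSupersolution [CompleteSpace E] [MeasureSpace E] (Ω : Set E) (cells : Set (Set E))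
    (b : E → ℝ → ℝ) (u : E → ℝ) : Prop :=
  u ∈ P1Space Ω cells ∧ ∀ v ∈ P1Space Ω cells, (∀ x, 0 ≤ v x) →
    IntegrableOn (fun x => b x (u x) * v x) Ω ∧ 0 ≤ weakForm Ω b u v

end General

section OneDim

/-- The interval `(a₀, aₙ)` subdivided by the nodes `a₀ < a₁ < ... < aₙ`. -/
def interval {n : ℕ} (a : Fin (n + 1) → ℝ) : Set ℝ := Set.Ioo (a 0) (a (Fin.last n))

/-- The cells `[a_{k-1}, a_k]`, `k = 1, ..., n`. -/
def intervalCells {n : ℕ} (a : Fin (n + 1) → ℝ) : Set (Set ℝ) :=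
  Set.range fun k : Fin n => Set.Icc (a k.castSucc) (a k.succ)

end OneDim

section TwoDim

/-- The plane with its Euclidean norm and Lebesgue measure. -/
abbrev Plane : Type := EuclideanSpace ℝ (Fin 2)

/-- `K` is a (finite, conforming) triangulation of the open set `Ω`, which exactly captures the
boundary: the triangles of `K` cover the closure of `Ω`, any two faces meet in a common face or
not at all (this is part of `Geometry.SimplicialComplex`), every vertex and edge belongs to a
triangle, and `∂Ω` is a union of edges. -/
structure IsTriangulation (K : Geometry.SimplicialComplex ℝ Plane) (Ω : Set Plane) : Prop where
  isOpen : IsOpen Ω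
  finite : K.faces.Finite
  pure : ∀ s ∈ K.faces, ∃ t ∈ K.faces, s ⊆ t ∧ t.card = 3
  space_eq : K.space = closure Ω
  frontier_eq : ∃ edges ⊆ K.faces, (∀ e ∈ edges, e.card = 2) ∧
    frontier Ω = ⋃ e ∈ edges, convexHull ℝ (e : Set Plane)

/-- The vertex sets of the triangles of `K`. -/
def triangles (K : Geometry.SimplicialComplex ℝ Plane) : Set (Finset Plane) :=
  {t | t ∈ K.faces ∧ t.card = 3}

/-- The closed triangles of `K`, as subsets of the plane. -/
def triangleCells (K : Geometry.SimplicialComplex ℝ Plane) : Set (Set Plane) :=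
  (fun t : Finset Plane => convexHull ℝ (t : Set Plane)) '' triangles K

/-- The set of the three interior angles of the triangle with vertex set `t`. -/
noncomputable def interiorAngles (t : Finset Plane) : Set ℝ :=
  {θ | ∃ p ∈ t, ∃ q ∈ t, ∃ r ∈ t, p ≠ q ∧ q ≠ r ∧ p ≠ r ∧ θ = EuclideanGeometry.angle p q r}

/-- The area of the triangle with vertex set `t`. -/
noncomputable def area (t : Finset Plane) : ℝ :=
  (volume (convexHull ℝ (t : Set Plane))).toReal

/-- Mesh regularity: all interior angles of all triangles lie in `[tmin, tmax]`, where
`0 < tmin ≤ tmax < π/2`. -/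
structure IsRegularMesh (K : Geometry.SimplicialComplex ℝ Plane) (tmin tmax : ℝ) : Prop where
  pos : 0 < tmin
  le : tmin ≤ tmax
  lt : tmax < Real.pi / 2
  angles : ∀ t ∈ triangles K, ∀ θ ∈ interiorAngles t, tmin ≤ θ ∧ θ ≤ tmax

end TwoDim

end SemilinearFEM

namespace SemilinearFEM

/-! ### Affine functions and their constant gradients. -/

section Affine

variable {E : Type*} [NormedAddCommGroup E] [InnerProductSpace ℝ E]

/-! Both dimensions follow from one comparison principle, `IsSimplicialMesh.le_of_isAcute`. Test
both inequalities with `v`, the nodal interpolant of the positive part of `w = u₁ - u₂` (the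
positive part itself need not be piecewise affine on the mesh). On a cell write `f` for `w` and `g`
for `v`; then `g - f` interpolates the negative part of `w`. Expanding in hat functions, the
products of `g - f` with `g` have no diagonal terms, since at each vertex one of the two vanishes.
The off-diagonal terms carry nonnegative nodal weights, multiplied by `∇φ_p · ∇φ_q + B φ_p φ_q`. As
`φ_p φ_q ≤ 1/4` on the cell, this is nonpositive as soon as `∇φ_p · ∇φ_q ≤ -B/4`, which is the
condition `IsAcute`.

Together with the monotonicity and the Lipschitz bound of `b`, this gives a pointwise estimate
(`IsAcute.norm_sq_le`): `|∇v|²` is at most the difference of the two weak-form integrands. That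
difference has nonpositive integral, so `∇v = 0` a.e., hence `v = 0`, and `u₁ ≤ u₂` at every vertex
and so everywhere.

It remains to derive `IsAcute` from the mesh conditions. In 1D the product of slopes is `-1/h²`; in
2D, `∇φ_p · ∇φ_q = -cot θ / |D|`, where `θ` is the angle at the third vertex and `D` the determinant
of the edges issuing from it. The assumed bounds are stronger than this argument needs. -/

theorem affineMap_eq_of_eqOn_of_span_eq_top {f g : E →ᵃ[ℝ] ℝ} {s : Set E}
    (hs : affineSpan ℝ s = ⊤) (h : EqOn f g s) : f = g :=
  AffineMap.ext_on hs h

theorem affineMap_eqOn_convexHull {f g : E →ᵃ[ℝ] ℝ} {s : Set E} (h : EqOn f g s) :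
    EqOn f g (convexHull ℝ s) := by
  have hc : Convex ℝ {x | (f - g) x = 0} := (convex_singleton (0 : ℝ)).affine_preimage (f - g)
  have hsub : convexHull ℝ s ⊆ {x | (f - g) x = 0} :=
    convexHull_min (fun x hx => by simp [h hx]) hc
  intro x hx
  have := hsub hx
  simpa [sub_eq_zero] using this

theorem affineMap_nonneg_convexHull {f : E →ᵃ[ℝ] ℝ} {s : Set E} (h : ∀ x ∈ s, 0 ≤ f x) :
    ∀ x ∈ convexHull ℝ s, 0 ≤ f x := by
  have hc : Convex ℝ (f ⁻¹' Ici 0) := (convex_Ici (0 : ℝ)).affine_preimage f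
  exact fun x hx => convexHull_min (t := f ⁻¹' Ici 0) h hc hx

theorem affineMap_sum_smul_apply {ι : Type*} (s : Finset ι) (c : ι → ℝ) (φ : ι → E →ᵃ[ℝ] ℝ)
    (x : E) : (∑ i ∈ s, c i • φ i) x = ∑ i ∈ s, c i * φ i x := by
  classical
  induction s using Finset.induction_on with
  | empty => simp
  | insert a s ha ih => simp [Finset.sum_insert ha, ih]

theorem exists_affineMap_of_affineIndependent {t : Finset E}
    (hi : AffineIndependent ℝ ((↑) : t → E)) (hs : affineSpan ℝ (t : Set E) = ⊤) (N : E → ℝ) :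
    ∃ g : E →ᵃ[ℝ] ℝ, ∀ p ∈ t, g p = N p := by
  classical
  let b : AffineBasis t ℝ E := ⟨(↑), hi, by simpa using hs⟩
  refine ⟨∑ p : t, N p • b.coord p, fun p hp => ?_⟩
  have hpt : ∀ i : t, b.coord i p = if i = ⟨p, hp⟩ then 1 else 0 := fun i => by
    exact b.coord_apply i ⟨p, hp⟩
  rw [affineMap_sum_smul_apply]
  simp [hpt]

variable [FiniteDimensional ℝ E] [CompleteSpace E]

/-- The constant gradient of an affine function. -/
noncomputable def affineGradient (f : E →ᵃ[ℝ] ℝ) : E :=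
  (InnerProductSpace.toDual ℝ E).symm (LinearMap.toContinuousLinearMap f.linear)

theorem inner_affineGradient (f : E →ᵃ[ℝ] ℝ) (x : E) :
    inner ℝ (affineGradient f) x = f.linear x := by
  simp [affineGradient]

theorem inner_affineGradient_sub (f : E →ᵃ[ℝ] ℝ) (x y : E) :
    inner ℝ (affineGradient f) (x - y) = f x - f y := by
  rw [inner_affineGradient, ← vsub_eq_sub, AffineMap.linearMap_vsub, vsub_eq_sub]

theorem affineGradient_sub (f g : E →ᵃ[ℝ] ℝ) :
    affineGradient (f - g) = affineGradient f - affineGradient g := by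
  refine ext_inner_right ℝ fun x => ?_
  simp [inner_affineGradient, inner_sub_left]

theorem affineGradient_eq_sum (t : Finset E) (c : E → ℝ) (φ : E → E →ᵃ[ℝ] ℝ) (f : E →ᵃ[ℝ] ℝ)
    (h : ∀ x, f x = ∑ p ∈ t, c p * φ p x) :
    affineGradient f = ∑ p ∈ t, c p • affineGradient (φ p) := by
  refine ext_inner_right ℝ fun x => ?_
  have h1 := inner_affineGradient_sub f x 0
  have h2 := fun p => inner_affineGradient_sub (φ p) x 0
  simp only [sub_zero] at h1 h2
  simp only [sum_inner, real_inner_smul_left, h1, h2, h, mul_sub, Finset.sum_sub_distrib]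

theorem hasGradientAt_affineMap (f : E →ᵃ[ℝ] ℝ) (x : E) :
    HasGradientAt f (affineGradient f) x := by
  rw [hasGradientAt_iff_hasFDerivAt]
  have : (InnerProductSpace.toDual ℝ E) (affineGradient f) =
      LinearMap.toContinuousLinearMap f.linear := by simp [affineGradient]
  rw [this]
  have h := (LinearMap.toContinuousLinearMap f.linear).hasFDerivAt (x := x)
  have h2 := h.add_const (f 0)
  refine h2.congr_of_eventuallyEq (Filter.Eventually.of_forall fun y => ?_)
  simp [AffineMap.decomp' f]

theorem gradient_eq_affineGradient {u : E → ℝ} {f : E →ᵃ[ℝ] ℝ} {T : Set E} (h : EqOn u f T)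
    {x : E} (hx : x ∈ interior T) : gradient u x = affineGradient f := by
  refine HasGradientAt.gradient ?_
  exact (hasGradientAt_affineMap f x).congr_of_eventuallyEq
    (Filter.eventually_of_mem (mem_interior_iff_mem_nhds.1 hx) h)

theorem eq_of_affineGradient_eq_zero {f : E →ᵃ[ℝ] ℝ} (h : affineGradient f = 0) (x y : E) :
    f x = f y := by
  have := inner_affineGradient_sub f x y
  rw [h, inner_zero_left] at this
  linarith

end Affine

/-! ### Hat functions and the pointwise estimate on one simplex. -/

section Simplex

variable {E : Type*} [NormedAddCommGroup E] [InnerProductSpace ℝ E]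

/-- `φ` is the family of hat functions (barycentric coordinates) of the simplex `t`. -/
def IsHatFamily (t : Finset E) (φ : E → E →ᵃ[ℝ] ℝ) : Prop :=
  ∀ p ∈ t, φ p p = 1 ∧ ∀ q ∈ t, q ≠ p → φ p q = 0

theorem exists_isHatFamily {t : Finset E} (hi : AffineIndependent ℝ ((↑) : t → E))
    (hs : affineSpan ℝ (t : Set E) = ⊤) : ∃ φ, IsHatFamily t φ := by
  classical
  choose φ hφ using fun p => exists_affineMap_of_affineIndependent hi hs (Pi.single p 1)
  exact ⟨φ, fun p hp => ⟨by simp [hφ p p hp], fun q hq hqp => by simp [hφ p q hq, hqp]⟩⟩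

variable {t : Finset E} {φ : E → E →ᵃ[ℝ] ℝ}

theorem IsHatFamily.eq_sum (hφ : IsHatFamily t φ) (hs : affineSpan ℝ (t : Set E) = ⊤)
    (f : E →ᵃ[ℝ] ℝ) (x : E) : f x = ∑ p ∈ t, f p * φ p x := by
  have : f = ∑ p ∈ t, f p • φ p := by
    refine affineMap_eq_of_eqOn_of_span_eq_top hs fun q hq => ?_
    rw [affineMap_sum_smul_apply, Finset.sum_eq_single_of_mem q hq, (hφ q hq).1, mul_one]
    intro p hp hpq
    rw [(hφ p hp).2 q hq hpq.symm, mul_zero]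
  conv_lhs => rw [this]
  exact affineMap_sum_smul_apply t _ _ x

theorem IsHatFamily.nonneg (hφ : IsHatFamily t φ) {p x : E} (hp : p ∈ t)
    (hx : x ∈ convexHull ℝ (t : Set E)) : 0 ≤ φ p x := by
  refine affineMap_nonneg_convexHull (fun q hq => ?_) x hx
  by_cases h : q = p
  · rw [h, (hφ p hp).1]; exact zero_le_one
  · rw [(hφ p hp).2 q hq h]

theorem IsHatFamily.sum_eq_one (hφ : IsHatFamily t φ) (hs : affineSpan ℝ (t : Set E) = ⊤)
    (x : E) : ∑ p ∈ t, φ p x = 1 := by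
  simpa using (hφ.eq_sum hs (AffineMap.const ℝ E 1) x).symm

/-- Two nonnegative numbers with sum at most 1 have product at most 1/4; this is the source of `B /
4` in `IsAcute`. -/
theorem IsHatFamily.mul_le (hφ : IsHatFamily t φ) (hs : affineSpan ℝ (t : Set E) = ⊤)
    {p q x : E} (hp : p ∈ t) (hq : q ∈ t) (hpq : p ≠ q)
    (hx : x ∈ convexHull ℝ (t : Set E)) : φ p x * φ q x ≤ 1 / 4 := by
  classical
  have h1 : φ p x + φ q x ≤ 1 := by
    rw [← hφ.sum_eq_one hs x, ← Finset.sum_pair (f := fun p => φ p x) hpq]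
    refine Finset.sum_le_sum_of_subset_of_nonneg ?_ fun i hi _ => hφ.nonneg hi hx
    simp [Finset.insert_subset_iff, hp, hq]
  have h0 := hφ.nonneg hp hx
  have h0' := hφ.nonneg hq hx
  nlinarith [sq_nonneg (φ p x - φ q x)]

variable [FiniteDimensional ℝ E] [CompleteSpace E]

/-- A quantitative acuteness condition on the simplex `t`, which makes the off-diagonal entries of
the local stiffness matrix dominate a reaction coefficient up to `B`. -/
def IsAcute (B : ℝ) (t : Finset E) : Prop :=
  ∀ φ, IsHatFamily t φ → ∀ p ∈ t, ∀ q ∈ t, p ≠ q →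
    inner ℝ (affineGradient (φ p)) (affineGradient (φ q)) ≤ -(B / 4)

/-- The pointwise coercivity estimate on a cell: `f` is the difference of the two discrete
functions, `g` is the nodal interpolant of its positive part, and `d` is the corresponding
difference of the values of the nonlinearity. -/
theorem IsAcute.norm_sq_le {B : ℝ} (hB : 0 ≤ B) (hi : AffineIndependent ℝ ((↑) : t → E))
    (hs : affineSpan ℝ (t : Set E) = ⊤) (ht : IsAcute B t) {f g : E →ᵃ[ℝ] ℝ}
    (hg : ∀ p ∈ t, g p = max (f p) 0) {x : E} (hx : x ∈ convexHull ℝ (t : Set E)) {d : ℝ}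
    (hd0 : 0 ≤ f x → 0 ≤ d) (hd1 : f x ≤ 0 → B * f x ≤ d) :
    ‖affineGradient g‖ ^ 2 ≤ inner ℝ (affineGradient f) (affineGradient g) + d * g x := by
  obtain ⟨φ, hφ⟩ := exists_isHatFamily hi hs
  have hgx : 0 ≤ g x := affineMap_nonneg_convexHull (fun p hp => by simp [hg p hp]) x hx
  have hz : ∀ p ∈ t, 0 ≤ (g - f) p := fun p hp => by simp [hg p hp]
  have hzx : 0 ≤ (g - f) x := affineMap_nonneg_convexHull hz x hx
  -- The sign of `f x` is not decided by the cell: where vertex values have both signs, `g x > 0`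
  -- and `f x < 0` can occur together. This bound covers both cases.
  have hd : -(B * (g - f) x) ≤ d := by
    rcases le_total 0 (f x) with h | h
    · have := hd0 h
      have := mul_nonneg hB hzx
      linarith
    · have h1 := hd1 h
      have : 0 ≤ B * g x := mul_nonneg hB hgx
      simp only [AffineMap.coe_sub, Pi.sub_apply]
      linarith
  have key : inner ℝ (affineGradient (g - f)) (affineGradient g) + B * (g - f) x * g x ≤ 0 := by
    rw [affineGradient_eq_sum t _ φ (g - f) (hφ.eq_sum hs _),
      affineGradient_eq_sum t _ φ g (hφ.eq_sum hs _), hφ.eq_sum hs (g - f) x, hφ.eq_sum hs g x]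
    rw [sum_inner, Finset.mul_sum t (fun p => (g - f) p * φ p x) B, Finset.sum_mul_sum]
    simp only [inner_sum, real_inner_smul_left, real_inner_smul_right]
    rw [← Finset.sum_add_distrib]
    refine Finset.sum_nonpos fun p hp => ?_
    rw [← Finset.sum_add_distrib]
    refine Finset.sum_nonpos fun q hq => ?_
    have hq0 : 0 ≤ g q := by simp [hg q hq]
    have hfactor : ∀ a b c : ℝ, g q * ((g - f) p * a) + B * ((g - f) p * b) * (g q * c) =
        (g - f) p * g q * (a + B * (b * c)) := fun a b c => by ring
    rw [hfactor]
    by_cases hpq : p = q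
    · subst hpq
      -- Positive and negative parts of `f p` cannot both be nonzero.
      have : (g - f) p * g p = 0 := by
        simp only [AffineMap.coe_sub, Pi.sub_apply, hg p hp]
        rcases le_total (f p) 0 with h | h <;> simp [h]
      rw [this, zero_mul]
    · have h1 := ht φ hφ p hp q hq hpq
      have h2 := mul_le_mul_of_nonneg_left (hφ.mul_le hs hp hq hpq hx) hB
      exact mul_nonpos_of_nonneg_of_nonpos (mul_nonneg (hz p hp) hq0) (by linarith)
  rw [affineGradient_sub, inner_sub_left, real_inner_self_eq_norm_sq] at key
  have := mul_le_mul_of_nonneg_right hd hgx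
  linarith

end Simplex

/-- An admissible nonlinearity is nondecreasing and its increments are at most `B` times the
increments of the argument. -/
theorem sub_bounds_of_deriv_bounds {β : ℝ → ℝ} {B : ℝ} (hβ : Differentiable ℝ β)
    (h : ∀ η, 0 ≤ deriv β η ∧ deriv β η ≤ B) (r s : ℝ) :
    (0 ≤ r - s → 0 ≤ β r - β s) ∧ (r - s ≤ 0 → B * (r - s) ≤ β r - β s) := by
  refine ⟨fun hrs => ?_, fun hrs => ?_⟩
  · have := monotone_of_deriv_nonneg hβ (fun η => (h η).1) (sub_nonneg.1 hrs)
    linarith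
  · have := image_sub_le_mul_sub_of_deriv_le hβ (fun η => (h η).2) (sub_nonpos.1 hrs)
    linarith

/-- A continuous function on a connected space with finite range is constant. -/
theorem eq_of_continuous_of_finite_range {X : Type*} [TopologicalSpace X] [PreconnectedSpace X]
    {v : X → ℝ} (hv : Continuous v) (hf : (range v).Finite) (x y : X) : v x = v y := by
  by_contra h
  exact (isPreconnected_range hv).infinite_of_nontrivial
    ⟨v x, mem_range_self x, v y, mem_range_self y, h⟩ hf

/-! ### Simplicial meshes and the comparison principle. -/

section Mesh

variable {E : Type*} [NormedAddCommGroup E] [InnerProductSpace ℝ E]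

/-- The simplices with vertex sets in `𝒯` are nondegenerate, full-dimensional and conforming,
cover `Ω`, and capture its boundary. -/
structure IsSimplicialMesh (Ω : Set E) (𝒯 : Set (Finset E)) : Prop where
  isOpen : IsOpen Ω
  finite : 𝒯.Finite
  indep : ∀ t ∈ 𝒯, AffineIndependent ℝ ((↑) : t → E)
  span : ∀ t ∈ 𝒯, affineSpan ℝ (t : Set E) = ⊤
  inter : ∀ s ∈ 𝒯, ∀ t ∈ 𝒯, convexHull ℝ (s : Set E) ∩ convexHull ℝ (t : Set E) ⊆
    convexHull ℝ (s ∩ t : Set E)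
  cover : ∀ x ∈ Ω, ∃ t ∈ 𝒯, x ∈ convexHull ℝ (t : Set E)
  boundary : ∀ t ∈ 𝒯, ∀ x ∈ convexHull ℝ (t : Set E), x ∉ Ω →
    x ∈ convexHull ℝ {p | p ∈ t ∧ p ∉ Ω}

/-- The cells of a mesh. -/
def hullCells (𝒯 : Set (Finset E)) : Set (Set E) :=
  (fun t : Finset E => convexHull ℝ (t : Set E)) '' 𝒯

variable {Ω : Set E} {𝒯 : Set (Finset E)}

/-- Functions of the P1 space can be prescribed at the vertices in `Ω`. -/
theorem IsSimplicialMesh.exists_interpolant [FiniteDimensional ℝ E] (h : IsSimplicialMesh Ω 𝒯) {N : E → ℝ}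
    (hN : ∀ p ∉ Ω, N p = 0) : ∃ v ∈ P1Space Ω (hullCells 𝒯), ∀ t ∈ 𝒯, ∀ p ∈ t, v p = N p := by
  classical
  have hex : ∀ t, t ∈ 𝒯 → ∃ g : E →ᵃ[ℝ] ℝ, ∀ p ∈ t, g p = N p := fun t ht =>
    exists_affineMap_of_affineIndependent (h.indep t ht) (h.span t ht) N
  choose! g hg using hex
  have hcompat : ∀ s ∈ 𝒯, ∀ t ∈ 𝒯, ∀ x ∈ convexHull ℝ (s : Set E),
      x ∈ convexHull ℝ (t : Set E) → g s x = g t x := fun s hs t ht x hxs hxt =>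
    affineMap_eqOn_convexHull (fun p hp => by rw [hg s hs p hp.1, hg t ht p hp.2])
      (h.inter s hs t ht ⟨hxs, hxt⟩)
  have hzero : ∀ t ∈ 𝒯, ∀ x ∈ convexHull ℝ (t : Set E), x ∉ Ω → g t x = 0 :=
    fun t ht x hx hxΩ => by
      have := affineMap_eqOn_convexHull (f := g t) (g := 0)
        (fun p hp => by simp [hg t ht p hp.1, hN p hp.2]) (h.boundary t ht x hx hxΩ)
      simpa using this
  have hv : ∃ v : E → ℝ, (∀ x, x ∉ Ω → v x = 0) ∧
      ∀ t ∈ 𝒯, EqOn v (g t) (convexHull ℝ (t : Set E)) := by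
    -- The choice of cell is immaterial: by conformity two cells meet within the hull of their
    -- common vertices, where the local interpolants agree.
    refine ⟨fun x => if hx : x ∈ Ω then g (h.cover x hx).choose x else 0,
      fun x hx => by simp [hx], fun t ht x hx => ?_⟩
    by_cases hxΩ : x ∈ Ω
    · have hc := (h.cover x hxΩ).choose_spec
      simp only [hxΩ, dite_true]
      exact hcompat _ hc.1 t ht x hc.2 hx
    · simp [hxΩ, hzero t ht x hx hxΩ]
  obtain ⟨v, hv0, hvt⟩ := hv
  refine ⟨v, ⟨?_, hv0, ?_⟩, fun t ht p hp => ?_⟩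
  · have hfin : Finite 𝒯 := h.finite
    -- Continuity is glued along a finite closed cover: the cells, and the complement of `Ω` as the
    -- extra index `none`.
    let C : Option 𝒯 → Set E := fun o => o.elim Ωᶜ fun t => convexHull ℝ (t.1 : Set E)
    refine (locallyFinite_of_finite C).continuous ?_ ?_ ?_
    · refine eq_univ_of_forall fun x => ?_
      by_cases hx : x ∈ Ω
      · obtain ⟨t, ht, hxt⟩ := h.cover x hx
        exact mem_iUnion.2 ⟨some ⟨t, ht⟩, hxt⟩
      · exact mem_iUnion.2 ⟨none, hx⟩
    · rintro (_ | t)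
      · exact h.isOpen.isClosed_compl
      · exact (t.1.finite_toSet.isCompact_convexHull ℝ).isClosed
    · rintro (_ | t)
      · exact continuousOn_const.congr fun x hx => hv0 x hx
      · exact (g t.1).continuous_of_finiteDimensional.continuousOn.congr (hvt t.1 t.2)
  · rintro _ ⟨t, ht, rfl⟩
    exact ⟨g t, hvt t ht⟩
  · rw [hvt t ht (subset_convexHull ℝ _ hp), hg t ht p hp]

theorem eqOn_of_mem_P1Space {u : E → ℝ} (hu : u ∈ P1Space Ω (hullCells 𝒯)) {t : Finset E}
    (ht : t ∈ 𝒯) : ∃ f : E →ᵃ[ℝ] ℝ, EqOn u f (convexHull ℝ (t : Set E)) :=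
  hu.2.2 _ ⟨t, ht, rfl⟩

theorem IsSimplicialMesh.nonneg_of_nonneg_vertices (h : IsSimplicialMesh Ω 𝒯) {u : E → ℝ}
    (hu : u ∈ P1Space Ω (hullCells 𝒯)) (hn : ∀ t ∈ 𝒯, ∀ p ∈ t, 0 ≤ u p) (x : E) : 0 ≤ u x := by
  by_cases hx : x ∈ Ω
  · obtain ⟨t, ht, hxt⟩ := h.cover x hx
    obtain ⟨f, hf⟩ := eqOn_of_mem_P1Space hu ht
    rw [hf hxt]
    refine affineMap_nonneg_convexHull (fun p hp => ?_) x hxt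
    rw [← hf (subset_convexHull ℝ _ hp)]
    exact hn t ht p hp
  · rw [hu.2.1 x hx]

theorem sub_mem_P1Space {cells : Set (Set E)} {u v : E → ℝ} (hu : u ∈ P1Space Ω cells)
    (hv : v ∈ P1Space Ω cells) : u - v ∈ P1Space Ω cells := by
  refine ⟨hu.1.sub hv.1, fun x hx => by simp [hu.2.1 x hx, hv.2.1 x hx], fun T hT => ?_⟩
  obtain ⟨f, hf⟩ := hu.2.2 T hT
  obtain ⟨g, hg⟩ := hv.2.2 T hT
  exact ⟨f - g, fun x hx => by simp [hf hx, hg hx]⟩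

variable [FiniteDimensional ℝ E] [MeasureSpace E] [BorelSpace E]
  [(volume : Measure E).IsAddHaarMeasure]

/-- Frontiers of convex sets are null, and there are finitely many cells. -/
theorem IsSimplicialMesh.ae_mem_interior (h : IsSimplicialMesh Ω 𝒯) :
    ∀ᵐ x ∂(volume.restrict Ω), ∃ t ∈ 𝒯, x ∈ interior (convexHull ℝ (t : Set E)) := by
  have h1 : ∀ t ∈ 𝒯, ∀ᵐ x : E, x ∉ frontier (convexHull ℝ (t : Set E)) := fun t _ =>
    measure_eq_zero_iff_ae_notMem.1 ((convex_convexHull ℝ (t : Set E)).addHaar_frontier volume)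
  have h2 := (ae_ball_iff h.finite.countable).2 h1
  filter_upwards [ae_restrict_of_ae h2, ae_restrict_mem h.isOpen.measurableSet] with x hx hxΩ
  obtain ⟨t, ht, hxt⟩ := h.cover x hxΩ
  refine ⟨t, ht, ?_⟩
  by_contra hc
  exact hx t ht ⟨subset_closure hxt, hc⟩

variable [CompleteSpace E]

theorem IsSimplicialMesh.integrableOn_inner_gradient (h : IsSimplicialMesh Ω 𝒯) {u v : E → ℝ}
    (hu : u ∈ P1Space Ω (hullCells 𝒯)) (hv : v ∈ P1Space Ω (hullCells 𝒯)) :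
    IntegrableOn (fun x => inner ℝ (gradient u x) (gradient v x)) Ω := by
  have h1 : IntegrableOn (fun x => inner ℝ (gradient u x) (gradient v x))
      (⋃ t ∈ 𝒯, interior (convexHull ℝ (t : Set E))) := by
    rw [integrableOn_finite_biUnion h.finite]
    intro t ht
    obtain ⟨f, hf⟩ := eqOn_of_mem_P1Space hu ht
    obtain ⟨g, hg⟩ := eqOn_of_mem_P1Space hv ht
    have hc : IntegrableOn (fun _ : E => inner ℝ (affineGradient f) (affineGradient g))
        (interior (convexHull ℝ (t : Set E))) := by
      refine integrableOn_const ?_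
      exact ((measure_mono interior_subset).trans_lt
        (t.finite_toSet.isCompact_convexHull ℝ).measure_lt_top).ne
    refine hc.congr_fun (fun x hx => ?_) isOpen_interior.measurableSet
    simp only [gradient_eq_affineGradient hf hx, gradient_eq_affineGradient hg hx]
  refine IntegrableOn.mono_set_ae h1 ?_
  have := (ae_restrict_iff' h.isOpen.measurableSet).1 h.ae_mem_interior
  filter_upwards [this] with x hx hxΩ
  exact mem_iUnion₂.2 (by simpa using hx hxΩ)

/-- A discrete function whose gradient vanishes almost everywhere vanishes. -/
theorem IsSimplicialMesh.eq_zero_of_gradient_eq_zero [Nontrivial E] (h : IsSimplicialMesh Ω 𝒯)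
    {v : E → ℝ} (hv : v ∈ P1Space Ω (hullCells 𝒯))
    (hg : ∀ᵐ x ∂(volume.restrict Ω), gradient v x = 0) (x : E) : v x = 0 := by
  -- With zero gradient `v` is constant on each cell that meets `Ω`, so its only values are vertex
  -- values and 0. Continuity on the connected space `E` then forces a single value.
  have hfin : (range v).Finite := by
    have hV : (⋃ t ∈ 𝒯, (t : Set E)).Finite := h.finite.biUnion fun t _ => t.finite_toSet
    refine ((hV.image v).union (finite_singleton 0)).subset ?_
    rintro _ ⟨y, rfl⟩
    by_cases hy : y ∈ Ω
    swap
    · exact Or.inr (hv.2.1 y hy)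
    left
    obtain ⟨t, ht, hyt⟩ := h.cover y hy
    obtain ⟨f, hf⟩ := eqOn_of_mem_P1Space hv ht
    have hne := interior_convexHull_nonempty_iff_affineSpan_eq_top.2 (h.span t ht)
    have hy' : y ∈ closure (interior (convexHull ℝ (t : Set E))) := by
      rw [(convex_convexHull ℝ _).closure_interior_eq_closure_of_nonempty_interior hne]
      exact subset_closure hyt
    -- The mesh axioms do not place cells inside the closure of `Ω`, so the a.e. hypothesis is used
    -- on this nonempty open set, which has positive measure.
    have hU : (Ω ∩ interior (convexHull ℝ (t : Set E))).Nonempty :=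
      mem_closure_iff.1 hy' Ω h.isOpen hy
    have hUo : IsOpen (Ω ∩ interior (convexHull ℝ (t : Set E))) := h.isOpen.inter isOpen_interior
    have hf0 : affineGradient f = 0 := by
      by_contra hf0
      refine (hUo.measure_pos volume hU).ne' ?_
      rw [ae_restrict_iff' h.isOpen.measurableSet] at hg
      rw [measure_eq_zero_iff_ae_notMem]
      filter_upwards [hg] with z hz hzU
      exact hf0 (by rw [← gradient_eq_affineGradient hf hzU.2, hz hzU.1])
    obtain ⟨p, hp⟩ : (t : Set E).Nonempty := convexHull_nonempty_iff.1 ⟨y, hyt⟩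
    refine ⟨p, mem_iUnion₂.2 ⟨t, ht, hp⟩, ?_⟩
    rw [hf hyt, hf (subset_convexHull ℝ _ hp)]
    exact eq_of_affineGradient_eq_zero hf0 p y
  -- Otherwise finitely many compact simplices would cover the noncompact space `E`. At such a point
  -- `v` is 0.
  obtain ⟨y, hy⟩ : ∃ y, y ∉ Ω := by
    by_contra hc
    push Not at hc
    have hb : Bornology.IsBounded (⋃ t ∈ 𝒯, convexHull ℝ (t : Set E)) :=
      (Bornology.isBounded_biUnion h.finite).2 fun t _ =>
        (t.finite_toSet.isCompact_convexHull ℝ).isBounded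
    have : NoncompactSpace E := NormedSpace.noncompactSpace ℝ E
    refine noncompact_univ E ?_
    have hu : (⋃ t ∈ 𝒯, convexHull ℝ (t : Set E)) = univ :=
      eq_univ_of_forall fun x => by simpa using h.cover x (hc x)
    rw [← hu]
    exact h.finite.isCompact_biUnion fun t _ => t.finite_toSet.isCompact_convexHull ℝ
  rw [eq_of_continuous_of_finite_range hv.1 hfin x y, hv.2.1 y hy]

/-- The discrete comparison principle on a sufficiently acute simplicial mesh. -/
theorem IsSimplicialMesh.le_of_isAcute [Nontrivial E] (h : IsSimplicialMesh Ω 𝒯)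
    {b : E → ℝ → ℝ} {B : ℝ} {u₁ u₂ : E → ℝ} (hb : IsAdmissible Ω b B)
    (h₁ : IsSubsolution Ω (hullCells 𝒯) b u₁) (h₂ : IsSupersolution Ω (hullCells 𝒯) b u₂)
    (ha : ∀ t ∈ 𝒯, IsAcute B t) (x : E) : u₁ x ≤ u₂ x := by
  obtain ⟨v, hv, hvN⟩ := h.exists_interpolant (N := fun p => max (u₁ p - u₂ p) 0)
    (fun p hp => by simp [h₁.1.2.1 p hp, h₂.1.2.1 p hp])
  have hv0 : ∀ x, 0 ≤ v x := h.nonneg_of_nonneg_vertices hv fun t ht p hp => by simp [hvN t ht p hp]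
  obtain ⟨hi₁, hw₁⟩ := h₁.2 v hv hv0
  obtain ⟨hi₂, hw₂⟩ := h₂.2 v hv hv0
  have hF₁ := (h.integrableOn_inner_gradient h₁.1 hv).add hi₁
  have hF₂ := (h.integrableOn_inner_gradient h₂.1 hv).add hi₂
  have hle : ∀ᵐ x ∂(volume.restrict Ω), ‖gradient v x‖ ^ 2 ≤
      (inner ℝ (gradient u₁ x) (gradient v x) + b x (u₁ x) * v x) -
        (inner ℝ (gradient u₂ x) (gradient v x) + b x (u₂ x) * v x) := by
    filter_upwards [h.ae_mem_interior, hb.contDiff, hb.deriv_bound] with x hx hxc hxd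
    obtain ⟨t, ht, hxt⟩ := hx
    obtain ⟨f₁, hf₁⟩ := eqOn_of_mem_P1Space h₁.1 ht
    obtain ⟨f₂, hf₂⟩ := eqOn_of_mem_P1Space h₂.1 ht
    obtain ⟨g, hg⟩ := eqOn_of_mem_P1Space hv ht
    have hxt' := interior_subset hxt
    obtain ⟨hd0, hd1⟩ := sub_bounds_of_deriv_bounds (hxc.differentiable one_ne_zero) hxd
      (u₁ x) (u₂ x)
    have key := (ha t ht).norm_sq_le hb.nonneg (h.indep t ht) (h.span t ht) (f := f₁ - f₂)
      (g := g) (fun p hp => by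
        have hp' := subset_convexHull ℝ (t : Set E) hp
        rw [← hg hp', hvN t ht p hp, hf₁ hp', hf₂ hp']
        simp) hxt' (d := b x (u₁ x) - b x (u₂ x))
      (by simpa [hf₁ hxt', hf₂ hxt'] using hd0) (by simpa [hf₁ hxt', hf₂ hxt'] using hd1)
    rw [gradient_eq_affineGradient hf₁ hxt, gradient_eq_affineGradient hf₂ hxt,
      gradient_eq_affineGradient hg hxt]
    rw [affineGradient_sub, inner_sub_left, ← hg hxt'] at key
    linarith
  have hint : ∫ x in Ω, ((inner ℝ (gradient u₁ x) (gradient v x) + b x (u₁ x) * v x) -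
        (inner ℝ (gradient u₂ x) (gradient v x) + b x (u₂ x) * v x)) ≤ 0 := by
    have := integral_sub hF₁ hF₂
    simp only [Pi.add_apply] at this
    rw [this]
    exact sub_nonpos.2 (hw₁.trans hw₂)
  have hnn := hle.mono fun x hx => (sq_nonneg ‖gradient v x‖).trans hx
  -- A nonnegative integrand with nonpositive integral vanishes a.e., and it dominates `‖∇v‖²`.
  have hz := (integral_eq_zero_iff_of_nonneg_ae hnn (hF₁.sub hF₂)).1
    (le_antisymm hint (integral_nonneg_of_ae hnn))
  have hvz := h.eq_zero_of_gradient_eq_zero hv (by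
    filter_upwards [hle, hz] with x hx hx0
    rw [hx0] at hx
    exact norm_eq_zero.1 (pow_eq_zero_iff two_ne_zero |>.1 (le_antisymm hx (sq_nonneg _))))
  have := h.nonneg_of_nonneg_vertices (sub_mem_P1Space h₂.1 h₁.1) (fun t ht p hp => by
    have h1 := hvN t ht p hp
    rw [hvz p] at h1
    have := le_max_left (u₁ p - u₂ p) 0
    simp only [Pi.sub_apply]
    linarith) x
  simpa using this

end Mesh

/-! ### The subdivided interval. -/

section OneDim

variable {n : ℕ} {a : Fin (n + 1) → ℝ}

/-- The vertex sets of the cells `[a_{k-1}, a_k]`. -/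
def intervalVertices (a : Fin (n + 1) → ℝ) : Set (Finset ℝ) :=
  range fun k : Fin n => {a k.castSucc, a k.succ}

theorem convexHull_pair_eq_Icc {r s : ℝ} (h : r ≤ s) :
    convexHull ℝ (({r, s} : Finset ℝ) : Set ℝ) = Icc r s := by
  rw [Finset.coe_pair, convexHull_pair, segment_eq_Icc h]

theorem hullCells_intervalVertices (ha : StrictMono a) :
    hullCells (intervalVertices a) = intervalCells a := by
  rw [hullCells, intervalVertices, intervalCells, ← range_comp]
  congr 1
  ext1 k
  exact convexHull_pair_eq_Icc (ha k.castSucc_lt_succ).le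

theorem isSimplicialMesh_interval (ha : StrictMono a) :
    IsSimplicialMesh (interval a) (intervalVertices a) := by
  have hlt : ∀ k : Fin n, a k.castSucc < a k.succ := fun k => ha k.castSucc_lt_succ
  have hhull : ∀ k : Fin n, convexHull ℝ (({a k.castSucc, a k.succ} : Finset ℝ) : Set ℝ) =
      Icc (a k.castSucc) (a k.succ) := fun k => convexHull_pair_eq_Icc (hlt k).le
  have hindep : ∀ t ∈ intervalVertices a, AffineIndependent ℝ ((↑) : t → ℝ) := by
    rintro _ ⟨k, rfl⟩
    have h := (affineIndependent_of_ne ℝ (hlt k).ne).range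
    have he : range ![a k.castSucc, a k.succ] =
        (({a k.castSucc, a k.succ} : Finset ℝ) : Set ℝ) := by
      ext x
      simp [or_comm]
    rw [he] at h
    exact h
  refine ⟨isOpen_Ioo, finite_range _, hindep, fun t ht => ?_, ?_, fun x hx => ?_, ?_⟩
  · have hi := hindep t ht
    have hc : Fintype.card t = Module.finrank ℝ ℝ + 1 := by
      obtain ⟨k, rfl⟩ := ht
      simp [Finset.card_pair (hlt k).ne]
    simpa using (hi.affineSpan_eq_top_iff_card_eq_finrank_add_one).2 hc
  -- Distinct cells share at most one point, the right end of the earlier cell and the left end of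
  -- the later one.
  · have hord : ∀ k l : Fin n, k < l → ∀ x ∈ Icc (a k.castSucc) (a k.succ),
        x ∈ Icc (a l.castSucc) (a l.succ) → x = a k.succ ∧ x = a l.castSucc := by
      intro k l hkl x hk hl
      have h1 : a k.succ ≤ a l.castSucc := ha.monotone (by
        rw [Fin.le_def]; simpa using Nat.succ_le_of_lt hkl)
      exact ⟨le_antisymm hk.2 (h1.trans hl.1), le_antisymm (hk.2.trans h1) hl.1⟩
    rintro _ ⟨k, rfl⟩ _ ⟨l, rfl⟩ x ⟨hk, hl⟩
    simp only [hhull] at hk hl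
    rcases lt_trichotomy k l with h | h | h
    · obtain ⟨h1, h2⟩ := hord k l h x hk hl
      exact subset_convexHull ℝ _ ⟨by simp [h1], by simp [h2]⟩
    · subst h
      rw [inter_self, hhull]
      exact hk
    · obtain ⟨h1, h2⟩ := hord l k h x hl hk
      exact subset_convexHull ℝ _ ⟨by simp [h2], by simp [h1]⟩
  · have hstep : ∀ k : Fin (n + 1), x ≤ a k →
        ∃ t ∈ intervalVertices a, x ∈ convexHull ℝ (t : Set ℝ) := by
      intro k
      induction k using Fin.induction with
      | zero => exact fun h => absurd hx.1 h.not_gt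
      | succ k ih =>
        intro h
        rcases le_total x (a k.castSucc) with h' | h'
        · exact ih h'
        · refine ⟨_, ⟨k, rfl⟩, ?_⟩
          simp only [hhull]
          exact ⟨h', h⟩
    exact hstep _ hx.2.le
  · rintro _ ⟨k, rfl⟩ x hx hxΩ
    refine subset_convexHull ℝ _ ⟨?_, hxΩ⟩
    simp only [hhull] at hx
    have h0 : a 0 ≤ a k.castSucc := ha.monotone (Fin.zero_le _)
    have h1 : a k.succ ≤ a (Fin.last n) := ha.monotone (Fin.le_last _)
    have hx' : x ≤ a 0 ∨ a (Fin.last n) ≤ x := by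
      by_contra hc
      push Not at hc
      exact hxΩ hc
    rcases hx' with h | h
    · simp [le_antisymm (h.trans h0) hx.1]
    · simp [le_antisymm hx.2 (h1.trans h)]

/-- The two hat functions have slopes `∓1/h` with `h = s - r`, so `IsAcute` amounts to `B h² ≤ 4`.
-/
theorem isAcute_pair {B r s : ℝ} (hrs : r < s) (h : 0 < B → (s - r) ^ 2 < 2 / B) :
    IsAcute B ({r, s} : Finset ℝ) := by
  intro φ hφ
  have hr := hφ r (by simp)
  have hs := hφ s (by simp)
  have hrs' := hr.2 s (by simp) hrs.ne'
  have hsr' := hs.2 r (by simp) hrs.ne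
  have h1 := inner_affineGradient_sub (φ r) s r
  have h2 := inner_affineGradient_sub (φ s) s r
  rw [hr.1, hrs', real_inner_comm] at h1
  rw [hs.1, hsr', real_inner_comm] at h2
  simp only [RCLike.inner_apply, conj_trivial] at h1 h2
  have key : affineGradient (φ r) * affineGradient (φ s) ≤ -(B / 4) := by
    set y := affineGradient (φ r)
    set z := affineGradient (φ s)
    have hd : 0 < s - r := sub_pos.2 hrs
    have hyz : (s - r) ^ 2 * (y * z) = -1 := by
      linear_combination (s - r) * z * h1 - h2
    have hB : B * (s - r) ^ 2 ≤ 2 := by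
      rcases le_or_gt B 0 with hB | hB
      · nlinarith [sq_nonneg (s - r)]
      · have := (lt_div_iff₀ hB).1 (h hB)
        linarith
    refine le_of_mul_le_mul_left ?_ (pow_pos hd 2)
    rw [hyz]
    linarith
  intro p hp q hq hpq
  simp only [Finset.mem_insert, Finset.mem_singleton] at hp hq
  simp only [RCLike.inner_apply, conj_trivial]
  rcases hp with rfl | rfl <;> rcases hq with rfl | rfl
  · exact absurd rfl hpq
  · rwa [mul_comm]
  · exact key
  · exact absurd rfl hpq

end OneDim

/-! ### Triangles and planar triangulations. -/

section TwoDim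

theorem inner_plane (x y : Plane) : inner ℝ x y = x 0 * y 0 + x 1 * y 1 := by
  simp [PiLp.inner_apply, Fin.sum_univ_two, mul_comm]

/-- The signed area of the parallelogram spanned by two vectors. -/
def planeDet (x y : Plane) : ℝ := x 0 * y 1 - x 1 * y 0

theorem volume_parallelepiped_plane (x y : Plane) :
    volume (parallelepiped ![x, y]) = ENNReal.ofReal |planeDet x y| := by
  have h := Measure.addHaar_parallelepiped (EuclideanSpace.basisFun (Fin 2) ℝ).toBasis ![x, y]
  rw [OrthonormalBasis.addHaar_eq_volume] at h
  rw [h]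
  congr 2
  rw [Module.Basis.det_apply, Matrix.det_fin_two]
  simp [Module.Basis.toMatrix_apply, planeDet]
  ring

/-- The parallelogram at `r` spanned by the two half edges lies inside the triangle. This loses a
factor 2 against the exact area `|D| / 2`, which the constant 3/7 can afford. -/
theorem planeDet_le_area {t : Finset Plane} {p q r : Plane} (hp : p ∈ t) (hq : q ∈ t)
    (hr : r ∈ t) : |planeDet (p - r) (q - r)| / 4 ≤ area t := by
  set x : Plane := (1 / 2 : ℝ) • (p - r)
  set y : Plane := (1 / 2 : ℝ) • (q - r)
  have hsub : (fun z => r + z) '' parallelepiped ![x, y] ⊆ convexHull ℝ (t : Set Plane) := by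
    rintro _ ⟨z, hz, rfl⟩
    obtain ⟨c, ⟨hc0, hc1⟩, rfl⟩ := (mem_parallelepiped_iff _ _).1 hz
    have h00 := hc0 0
    have h01 := hc0 1
    have h10 := hc1 0
    have h11 := hc1 1
    simp only [Pi.zero_apply, Pi.one_apply] at h00 h01 h10 h11
    have hcomb := (convex_convexHull ℝ (t : Set Plane)).sum_mem (t := Finset.univ)
      (w := ![c 0 / 2, c 1 / 2, 1 - c 0 / 2 - c 1 / 2]) (z := ![p, q, r])
      (by
        intro i _
        fin_cases i <;> simp <;> linarith)
      (by simp [Fin.sum_univ_three])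
      (by
        intro i _
        fin_cases i <;> exact subset_convexHull ℝ _ (by simpa))
    convert hcomb using 1
    simp only [Fin.sum_univ_two, Fin.sum_univ_three, x, y, Matrix.cons_val_zero,
      Matrix.cons_val_one, Matrix.cons_val]
    module
  have hvol : volume ((fun z => r + z) '' parallelepiped ![x, y]) =
      ENNReal.ofReal (|planeDet (p - r) (q - r)| / 4) := by
    rw [image_add_left, measure_preimage_add, volume_parallelepiped_plane]
    congr 1
    have : planeDet x y = planeDet (p - r) (q - r) / 4 := by
      simp [planeDet, x, y]
      ring
    rw [this, abs_div]
    norm_num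
  have hfin : volume (convexHull ℝ (t : Set Plane)) ≠ ⊤ :=
    (t.finite_toSet.isCompact_convexHull ℝ).measure_lt_top.ne
  refine (ENNReal.ofReal_le_iff_le_toReal hfin).1 ?_
  rw [← hvol]
  exact measure_mono hsub

theorem sq_planeDet (x y : Plane) :
    planeDet x y ^ 2 = inner ℝ x x * inner ℝ y y - inner ℝ x y * inner ℝ x y := by
  simp only [inner_plane, planeDet]
  ring

theorem cot_angle_mul_abs_planeDet (x y : Plane) (h : planeDet x y ≠ 0) :
    Real.cot (InnerProductGeometry.angle x y) * |planeDet x y| = inner ℝ x y := by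
  have hs := InnerProductGeometry.sin_angle_mul_norm_mul_norm x y
  have hc := InnerProductGeometry.cos_angle_mul_norm_mul_norm x y
  rw [← sq_planeDet, Real.sqrt_sq_eq_abs] at hs
  have hs0 : Real.sin (InnerProductGeometry.angle x y) ≠ 0 := by
    intro h0
    rw [h0, zero_mul] at hs
    exact h (abs_eq_zero.1 hs.symm)
  rw [Real.cot_eq_cos_div_sin, ← hs, ← hc]
  field_simp

/-- If `y, z` is the dual basis of `a, c`, their inner product is read off from `a, c`. -/
theorem planeDet_dual {a c y z : Plane} (hya : inner ℝ y a = 1) (hyc : inner ℝ y c = 0)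
    (hza : inner ℝ z a = 0) (hzc : inner ℝ z c = 1) :
    planeDet a c ≠ 0 ∧ planeDet a c ^ 2 * inner ℝ y z = -inner ℝ a c := by
  simp only [inner_plane] at *
  -- Cramer's rule for the dual basis.
  have hy0 : y 0 * planeDet a c = c 1 := by
    rw [planeDet]; linear_combination c 1 * hya - a 1 * hyc
  have hy1 : y 1 * planeDet a c = -c 0 := by
    rw [planeDet]; linear_combination -c 0 * hya + a 0 * hyc
  have hz0 : z 0 * planeDet a c = -a 1 := by
    rw [planeDet]; linear_combination c 1 * hza - a 1 * hzc
  have hz1 : z 1 * planeDet a c = a 0 := by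
    rw [planeDet]; linear_combination -c 0 * hza + a 0 * hzc
  refine ⟨fun h0 => ?_, ?_⟩
  · rw [h0, mul_zero] at hy0 hy1
    rw [← hy0, neg_eq_zero.1 hy1.symm] at hzc
    simp at hzc
  · linear_combination (z 0 * planeDet a c) * hy0 + (z 1 * planeDet a c) * hy1 + c 1 * hz0 -
      c 0 * hz1

/-- The gradients of `φ p` and `φ q` are dual to the edges from the third vertex `r`, so their
product is `-cot θ / |D|`. The claim becomes `B |D| / 4 ≤ cot θ`, while `|D| ≤ 4 |T|` and the area
bound give `B |D| / 4 < (3/7) cot θ`. -/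
theorem isAcute_triangle {B : ℝ} (hB : 0 ≤ B) {t : Finset Plane} (ht : t.card = 3)
    (hangle : ∀ θ ∈ interiorAngles t, θ ≤ Real.pi / 2)
    (harea : 0 < B → ∀ θ ∈ interiorAngles t, area t < 3 / (7 * B) * Real.cot θ) :
    IsAcute B t := by
  intro φ hφ p hp q hq hpq
  obtain ⟨r, hr, hrp, hrq⟩ : ∃ r ∈ t, r ≠ p ∧ r ≠ q := by
    classical
    have hcard : ((t.erase p).erase q).card = 1 := by
      rw [Finset.card_erase_of_mem (Finset.mem_erase.2 ⟨hpq.symm, hq⟩),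
        Finset.card_erase_of_mem hp, ht]
    obtain ⟨r, hr⟩ := Finset.card_pos.1 (hcard ▸ one_pos)
    simp only [Finset.mem_erase] at hr
    exact ⟨r, hr.2.2, hr.2.1, hr.1⟩
  have hval : ∀ s ∈ t, φ s s = 1 := fun s hs => (hφ s hs).1
  have hval0 : ∀ s ∈ t, ∀ s' ∈ t, s' ≠ s → φ s s' = 0 := fun s hs => (hφ s hs).2
  obtain ⟨hD, hyz⟩ := planeDet_dual (a := p - r) (c := q - r) (y := affineGradient (φ p))
    (z := affineGradient (φ q))
    (by rw [inner_affineGradient_sub, hval p hp, hval0 p hp r hr hrp, sub_zero])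
    (by rw [inner_affineGradient_sub, hval0 p hp q hq hpq.symm, hval0 p hp r hr hrp, sub_zero])
    (by rw [inner_affineGradient_sub, hval0 q hq p hp hpq, hval0 q hq r hr hrq, sub_zero])
    (by rw [inner_affineGradient_sub, hval q hq, hval0 q hq r hr hrq, sub_zero])
  have hθ : EuclideanGeometry.angle p r q ∈ interiorAngles t :=
    ⟨p, hp, r, hr, q, hq, hrp.symm, hrq, hpq, rfl⟩
  have hcot := cot_angle_mul_abs_planeDet (p - r) (q - r) hD
  have hDpos : 0 < |planeDet (p - r) (q - r)| := abs_pos.2 hD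
  have hsq : 0 < planeDet (p - r) (q - r) ^ 2 := by positivity
  have hmain : B / 4 * planeDet (p - r) (q - r) ^ 2 ≤ inner ℝ (p - r) (q - r) := by
    rcases hB.eq_or_lt with rfl | hB
    -- For `B = 0` there is no area condition; non-obtuseness of the angle at `r` suffices.
    · rw [zero_div, zero_mul, ← InnerProductGeometry.cos_angle_mul_norm_mul_norm]
      have hcos := Real.cos_nonneg_of_neg_pi_div_two_le_of_le
        ((neg_nonpos.2 Real.pi_div_two_pos.le).trans
          (InnerProductGeometry.angle_nonneg (p - r) (q - r))) (hangle _ hθ)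
      positivity
    · have h1 := (planeDet_le_area hp hq hr).trans_lt (harea hB _ hθ)
      have h2 : |planeDet (p - r) (q - r)| / 4 * (7 * B) <
          3 * Real.cot (EuclideanGeometry.angle p r q) := by
        rw [div_mul_eq_mul_div, lt_div_iff₀ (by positivity)] at h1
        exact h1
      have h3 := mul_lt_mul_of_pos_right h2 hDpos
      have h4 : Real.cot (EuclideanGeometry.angle p r q) * |planeDet (p - r) (q - r)| =
        inner ℝ (p - r) (q - r) := hcot
      rw [mul_assoc 3, h4] at h3
      have h5 := mul_pos hB hsq
      rw [← sq_abs] at h5 ⊢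
      nlinarith
  refine le_of_mul_le_mul_left ?_ hsq
  rw [hyz]
  linarith

/-- The point to check is `boundary`: a point of a triangle outside `Ω` lies on a boundary edge,
hence in the hull of the vertices common to triangle and edge. Those vertices are on the frontier,
so outside the open set `Ω`. -/
theorem IsTriangulation.isSimplicialMesh {K : Geometry.SimplicialComplex ℝ Plane}
    {Ω : Set Plane} (h : IsTriangulation K Ω) : IsSimplicialMesh Ω (triangles K) := by
  refine ⟨h.isOpen, h.finite.subset fun t ht => ht.1, fun t ht => K.indep ht.1, fun t ht => ?_,
    fun s hs t ht => K.inter_subset_convexHull hs.1 ht.1, fun x hx => ?_, fun t ht x hx hxΩ => ?_⟩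
  · have hc : Fintype.card t = Module.finrank ℝ Plane + 1 := by simp [ht.2]
    simpa using ((K.indep ht.1).affineSpan_eq_top_iff_card_eq_finrank_add_one).2 hc
  · have hxK : x ∈ K.space := by
      rw [h.space_eq]
      exact subset_closure hx
    obtain ⟨s, hs, hxs⟩ := Geometry.SimplicialComplex.mem_space_iff.1 hxK
    obtain ⟨t, ht, hst, hcard⟩ := h.pure s hs
    exact ⟨t, ⟨ht, hcard⟩, convexHull_mono (by exact_mod_cast hst) hxs⟩
  · obtain ⟨edges, hedges, -, hfr⟩ := h.frontier_eq
    have hxf : x ∈ frontier Ω := by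
      rw [h.isOpen.frontier_eq, ← h.space_eq]
      exact ⟨K.convexHull_subset_space ht.1 hx, hxΩ⟩
    rw [hfr] at hxf
    obtain ⟨e, he, hxe⟩ := mem_iUnion₂.1 hxf
    refine convexHull_mono ?_ (K.inter_subset_convexHull ht.1 (hedges he) ⟨hx, hxe⟩)
    rintro p ⟨hpt, hpe⟩
    refine ⟨hpt, fun hpΩ => ?_⟩
    have hpf : p ∈ frontier Ω := by
      rw [hfr]
      exact mem_iUnion₂.2 ⟨e, he, subset_convexHull ℝ _ hpe⟩
    rw [h.isOpen.frontier_eq] at hpf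
    exact hpf.2 hpΩ

end TwoDim

end SemilinearFEM

theorem theorem5p1 :
    -- one space dimension
    (∀ (n : ℕ) (a : Fin (n + 1) → ℝ) (b : ℝ → ℝ → ℝ) (B : ℝ) (u₁ u₂ : ℝ → ℝ),
      1 ≤ n →
      StrictMono a →
      SemilinearFEM.IsAdmissible (SemilinearFEM.interval a) b B →
      SemilinearFEM.IsSubsolution (SemilinearFEM.interval a) (SemilinearFEM.intervalCells a) b u₁ →
      SemilinearFEM.IsSupersolution (SemilinearFEM.interval a) (SemilinearFEM.intervalCells a)
        b u₂ →
      -- the mesh condition is void if `B = 0`, where the bound is `+∞`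
      (0 < B → ∀ k : Fin n, (a k.succ - a k.castSucc) ^ 2 < 2 / B) →
      ∀ x ∈ SemilinearFEM.interval a, u₁ x ≤ u₂ x) ∧
    -- two space dimensions
    (∀ (Ω : Set SemilinearFEM.Plane) (K : Geometry.SimplicialComplex ℝ SemilinearFEM.Plane)
      (tmin tmax : ℝ) (b : SemilinearFEM.Plane → ℝ → ℝ) (B : ℝ)
      (u₁ u₂ : SemilinearFEM.Plane → ℝ),
      SemilinearFEM.IsTriangulation K Ω →
      SemilinearFEM.IsRegularMesh K tmin tmax →
      SemilinearFEM.IsAdmissible Ω b B →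
      SemilinearFEM.IsSubsolution Ω (SemilinearFEM.triangleCells K) b u₁ →
      SemilinearFEM.IsSupersolution Ω (SemilinearFEM.triangleCells K) b u₂ →
      (0 < B → ∀ t ∈ SemilinearFEM.triangles K, ∀ θ ∈ SemilinearFEM.interiorAngles t,
        SemilinearFEM.area t < 3 / (7 * B) * Real.cot θ) →
      ∀ x ∈ Ω, u₁ x ≤ u₂ x) := by
  refine ⟨fun n a b B u₁ u₂ _ ha hb h₁ h₂ hmesh x _ => ?_,
    fun Ω K tmin tmax b B u₁ u₂ hK hreg hb h₁ h₂ hmesh x _ => ?_⟩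
  · rw [← SemilinearFEM.hullCells_intervalVertices ha] at h₁ h₂
    refine (SemilinearFEM.isSimplicialMesh_interval ha).le_of_isAcute hb h₁ h₂ ?_ x
    rintro _ ⟨k, rfl⟩
    exact SemilinearFEM.isAcute_pair (ha k.castSucc_lt_succ) fun hB => hmesh hB k
  · exact hK.isSimplicialMesh.le_of_isAcute hb h₁ h₂ (fun t ht =>
      SemilinearFEM.isAcute_triangle hb.nonneg ht.2
        (fun θ hθ => ((hreg.angles t ht θ hθ).2.trans_lt hreg.lt).le)
        fun hB => hmesh hB t ht) x
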